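/- **Proposition 2.1.** Let $D\subset\mathbb{R}^n$ be a bounded convex polyhedron (a polytope, i.e. the convex hull of a finite set of points), let $D_0$ be its set of vertices (extreme points), and let $D_1$ be its 1-skeleton, i.e. the union of the faces of $D$ of dimension at most $1$. Let $U\subset\mathbb{R}^n$ be an arbitrary convex set (not necessarily closed or open). A path-connected component of a set $P\subset\mathbb{R}^n$ is a maximal nonempty path-connected subset of $P$. Then $D\setminus U$ has finitely many path-connected components $W_1,\dots,W_q$ (listed without repetition, $q\ge 0$), and: 1. $W_i\cap D_0\neq\emptyset$ for every $i=1,\dots,q$; 2. $D_1\setminus U$ has exactly $q$ path-connected components, and these are the pairwise distinct sets $W_1\cap D_1,\dots,W_q\cap D_1$. -/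

import Mathlib

/-- A (bounded) convex polyhedron, i.e. a polytope: the convex hull of a finite set of points. -/
def IsPolytope {n : ℕ} (D : Set (EuclideanSpace ℝ (Fin n))) : Prop :=
  ∃ V : Set (EuclideanSpace ℝ (Fin n)), V.Finite ∧ D = convexHull ℝ V

/-- A face of `D`: a convex subset `F` of `D` such that every segment of `D` with a relatively
interior point in `F` lies in `F`.  Both `D` itself and the empty set are allowed. -/
def IsFace {n : ℕ} (D F : Set (EuclideanSpace ℝ (Fin n))) : Prop :=
  Convex ℝ F ∧ IsExtreme ℝ D F

/-- The `k`-skeleton of `D`: the union of the faces of dimension at most `k`, the dimension of a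
face being that of its affine span.  For a polytope with `k ≤ dim D` this is the union of the
`k`-dimensional faces; for `dim D < k` it is `D`. -/
def skeleton {n : ℕ} (D : Set (EuclideanSpace ℝ (Fin n))) (k : ℕ) :
    Set (EuclideanSpace ℝ (Fin n)) :=
  {x | ∃ F, IsFace D F ∧ Module.finrank ℝ (vectorSpan ℝ F) ≤ k ∧ x ∈ F}

/-- The set of all path-connected components of `P`: the maximal (nonempty) path-connected
subsets of `P`. -/
def pathConnectedComponents {X : Type*} [TopologicalSpace X] (P : Set X) : Set (Set X) :=
  {W | Maximal (fun S : Set X => S ⊆ P ∧ IsPathConnected S) W}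

/-! A point of a face outside `U` sees, within that face, a vertex outside `U`
(`IsFace.exists_segment_disjoint`). So every component of `D \ U` or of `skeleton D 1 \ U` contains
a vertex, and there are finitely many. It remains to link two vertices of one component of `D \ U`
by edges missing `U`.

Inside a half-space this is the simplex method: climb along edges to the face where the functional
is maximal, whose edge graph is connected. For closed `U`, every point of a connected set outside
`U` lies in a half-space missing `U`; when two such half-spaces share a point of `D`, turning one
into the other links their vertices, and connectedness does the rest. An arbitrary convex `U` is
replaced by the hull of finitely many of its points. -/

/-! ### Faces, vertices and skeleta -/

theorem IsPolytope.convex {n : ℕ} {D : Set (EuclideanSpace ℝ (Fin n))} (hD : IsPolytope D) :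
    Convex ℝ D := by
  obtain ⟨V, -, rfl⟩ := hD
  exact convex_convexHull ℝ V

theorem IsPolytope.finite_extremePoints {n : ℕ} {D : Set (EuclideanSpace ℝ (Fin n))}
    (hD : IsPolytope D) : (D.extremePoints ℝ).Finite := by
  obtain ⟨V, hV, rfl⟩ := hD
  exact hV.subset extremePoints_convexHull_subset

theorem IsPolytope.convexHull_extremePoints {n : ℕ} {D : Set (EuclideanSpace ℝ (Fin n))}
    (hD : IsPolytope D) : convexHull ℝ (D.extremePoints ℝ) = D := by
  have hfin := hD.finite_extremePoints
  have hcv := hD.convex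
  obtain ⟨V, hV, hDV⟩ := hD
  have hc : IsCompact D := hDV ▸ hV.isCompact_convexHull ℝ
  have h := closure_convexHull_extremePoints hc hcv
  rwa [(hfin.isCompact_convexHull ℝ).isClosed.closure_eq] at h

theorem IsFace.subset {n : ℕ} {D F : Set (EuclideanSpace ℝ (Fin n))} (hF : IsFace D F) : F ⊆ D :=
  hF.2.subset

theorem IsFace.self {n : ℕ} {D : Set (EuclideanSpace ℝ (Fin n))} (hD : IsPolytope D) :
    IsFace D D :=
  ⟨hD.convex, IsExtreme.rfl⟩

/-- A face of a polytope is the convex hull of the vertices it contains. -/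
theorem IsFace.eq_convexHull {n : ℕ} {D F : Set (EuclideanSpace ℝ (Fin n))} (hD : IsPolytope D)
    (hF : IsFace D F) : F = convexHull ℝ (D.extremePoints ℝ ∩ F) := by
  refine Set.Subset.antisymm (fun x hx => ?_) (convexHull_min Set.inter_subset_right hF.1)
  have hdiff : Convex ℝ (D \ F) := hF.2.convex_sdiff hD.convex
  have hsub : convexHull ℝ (D.extremePoints ℝ \ F) ⊆ D \ F :=
    convexHull_min (fun y hy => ⟨extremePoints_subset hy.1, hy.2⟩) hdiff
  have hxD : x ∈ convexHull ℝ ((D.extremePoints ℝ ∩ F) ∪ (D.extremePoints ℝ \ F)) := by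
    rw [Set.inter_union_sdiff, hD.convexHull_extremePoints]
    exact hF.subset hx
  rcases Set.eq_empty_or_nonempty (D.extremePoints ℝ \ F) with h2 | h2
  · rwa [h2, Set.union_empty] at hxD
  rcases Set.eq_empty_or_nonempty (D.extremePoints ℝ ∩ F) with h1 | h1
  · rw [h1, Set.empty_union] at hxD
    exact absurd hx (hsub hxD).2
  rw [convexHull_union h1 h2, mem_convexJoin] at hxD
  obtain ⟨p, hp, q, hq, hxpq⟩ := hxD
  have hpF : p ∈ F := convexHull_min Set.inter_subset_right hF.1 hp
  rw [← insert_endpoints_openSegment] at hxpq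
  rcases hxpq with rfl | rfl | ho
  · exact hp
  · exact absurd hx (hsub hq).2
  · exact absurd (hF.2.right_mem_of_mem_openSegment (hF.subset hpF) (hsub hq).1 hx ho) (hsub hq).2

theorem IsFace.isPolytope {n : ℕ} {D F : Set (EuclideanSpace ℝ (Fin n))} (hD : IsPolytope D)
    (hF : IsFace D F) : IsPolytope F :=
  ⟨_, hD.finite_extremePoints.subset Set.inter_subset_left, hF.eq_convexHull hD⟩

theorem IsFace.trans {n : ℕ} {D F G : Set (EuclideanSpace ℝ (Fin n))} (hF : IsFace D F)
    (hG : IsFace F G) : IsFace D G :=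
  ⟨hG.1, hF.2.trans hG.2⟩

theorem skeleton_subset {n : ℕ} (D : Set (EuclideanSpace ℝ (Fin n))) (k : ℕ) :
    skeleton D k ⊆ D := by
  rintro x ⟨F, hF, -, hx⟩
  exact hF.subset hx

theorem IsFace.skeleton_subset {n : ℕ} {D F : Set (EuclideanSpace ℝ (Fin n))} (hF : IsFace D F)
    (k : ℕ) : skeleton F k ⊆ skeleton D k := by
  rintro x ⟨G, hG, hk, hx⟩
  exact ⟨G, hF.trans hG, hk, hx⟩

theorem extremePoints_subset_skeleton {n : ℕ} (D : Set (EuclideanSpace ℝ (Fin n))) (k : ℕ) :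
    D.extremePoints ℝ ⊆ skeleton D k := by
  intro v hv
  refine ⟨{v}, ⟨convex_singleton v, isExtreme_singleton.2 hv⟩, ?_, rfl⟩
  rw [vectorSpan_singleton, finrank_bot]
  exact Nat.zero_le k

/-- Every point of a face outside a convex set `U` sees a vertex of the face. -/
theorem IsFace.exists_segment_disjoint {n : ℕ} {D F U : Set (EuclideanSpace ℝ (Fin n))}
    (hD : IsPolytope D) (hF : IsFace D F) (hU : Convex ℝ U) {x : EuclideanSpace ℝ (Fin n)}
    (hx : x ∈ F) (hxU : x ∉ U) :
    ∃ v ∈ D.extremePoints ℝ, segment ℝ x v ⊆ F \ U := by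
  -- Enlarging `U` to a convex set with convex complement replaces a separating hyperplane, so `U`
  -- need be neither open nor closed.
  obtain ⟨C, hC, hC', hUC, hxC⟩ := exists_convex_convex_compl_subset hU (convex_singleton x)
    (Set.disjoint_singleton_right.2 hxU)
  have hxC : x ∉ C := hxC rfl
  obtain ⟨v, hv, hvC⟩ : ∃ v ∈ D.extremePoints ℝ ∩ F, v ∉ C := by
    by_contra! h
    rw [hF.eq_convexHull hD] at hx
    exact hxC (convexHull_min h hC hx)
  exact ⟨v, hv.1, fun y hy => ⟨hF.1.segment_subset hx hv.2 hy,
    fun hyU => hC'.segment_subset hxC hvC hy (hUC hyU)⟩⟩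

/-! ### Ascending edges via the vertex figure -/

/-- A linear functional that is not maximal on `D` at a vertex `v` increases along some edge
issuing from `v`. -/
theorem IsPolytope.exists_ascending_edge {n : ℕ} {D : Set (EuclideanSpace ℝ (Fin n))}
    (hD : IsPolytope D) (f : StrongDual ℝ (EuclideanSpace ℝ (Fin n)))
    {v y : EuclideanSpace ℝ (Fin n)} (hv : v ∈ D.extremePoints ℝ) (hy : y ∈ D) (hvy : f v < f y) :
    ∃ w ∈ D.extremePoints ℝ, f v < f w ∧ segment ℝ v w ⊆ skeleton D 1 := by
  have hfin := hD.finite_extremePoints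
  obtain ⟨g, u, hgu, hug⟩ : ∃ (g : StrongDual ℝ (EuclideanSpace ℝ (Fin n))) (u : ℝ),
      (∀ a ∈ convexHull ℝ (D.extremePoints ℝ \ {v}), g a < u) ∧ u < g v := by
    refine geometric_hahn_banach_closed_point (convex_convexHull ℝ _)
      ((hfin.subset Set.sdiff_subset).isCompact_convexHull ℝ).isClosed fun hmem => ?_
    exact (convexHull_min (Set.sdiff_subset_sdiff_left extremePoints_subset)
      (hD.convex.mem_extremePoints_iff_convex_sdiff.1 hv).2 hmem).2 rfl
  have hg : ∀ w ∈ D.extremePoints ℝ \ {v}, 0 < g v - g w := fun w hw => by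
    linarith [hgu w (subset_convexHull ℝ _ hw)]
  -- the vertex figure of `D` at `v`
  set q : EuclideanSpace ℝ (Fin n) → EuclideanSpace ℝ (Fin n) :=
    fun w => (g v - g w)⁻¹ • (w - v) with hq
  set P := convexHull ℝ (q '' (D.extremePoints ℝ \ {v})) with hPdef
  have hP : IsPolytope P := ⟨_, (hfin.subset Set.sdiff_subset).image q, rfl⟩
  have hqw : ∀ w ∈ D.extremePoints ℝ \ {v}, w - v = (g v - g w) • q w := fun w hw => by
    rw [hq, smul_smul, mul_inv_cancel₀ (hg w hw).ne', one_smul]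
  have hgP : ∀ p ∈ P, g p = -1 := by
    refine fun p hp => convexHull_min (t := {p | g p = -1}) ?_
      (convex_hyperplane g.toLinearMap.isLinear _) hp
    rintro _ ⟨w, hw, rfl⟩
    have h0 := (hg w hw).ne'
    simp only [hq, Set.mem_ofPred_eq, map_smul, map_sub, smul_eq_mul]
    field_simp
    ring
  obtain ⟨w, hw, hfw⟩ : ∃ w ∈ D.extremePoints ℝ, f v < f w := by
    by_contra! h
    rw [← hD.convexHull_extremePoints] at hy
    exact hvy.not_ge (convexHull_min (t := {z | f z ≤ f v}) h
      (convex_halfSpace_le f.toLinearMap.isLinear _) hy)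
  have hwv : w ∈ D.extremePoints ℝ \ {v} := ⟨hw, fun h => by
    rw [Set.mem_singleton_iff.1 h] at hfw; exact lt_irrefl _ hfw⟩
  have hqwP : q w ∈ P := subset_convexHull ℝ _ ⟨w, hwv, rfl⟩
  -- `D` lies in the cone with apex `v` over the vertex figure, so edges at `v` can be found as rays
  -- through extreme points of `P`.
  have hcone : ∀ a ∈ D, ∃ s : ℝ, 0 ≤ s ∧ ∃ p ∈ P, a - v = s • p := by
    intro a ha
    rw [← hD.convexHull_extremePoints] at ha
    refine convexHull_min (t := {a | ∃ s : ℝ, 0 ≤ s ∧ ∃ p ∈ P, a - v = s • p}) ?_ ?_ ha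
    · intro b hb
      by_cases hbv : b = v
      · exact ⟨0, le_rfl, q w, hqwP, by simp [hbv]⟩
      · exact ⟨_, (hg b ⟨hb, hbv⟩).le, q b, subset_convexHull ℝ _ ⟨b, ⟨hb, hbv⟩, rfl⟩,
          hqw b ⟨hb, hbv⟩⟩
    · rintro a ⟨s, hs, p, hp, hap⟩ b ⟨t, ht, r, hr, hbr⟩ α β hα hβ hαβ
      have hcomb : α • a + β • b - v = (α * s) • p + (β * t) • r := by
        rw [mul_smul, mul_smul, ← hap, ← hbr]
        have : v = (α + β) • v := by rw [hαβ, one_smul]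
        nth_rw 1 [this]
        module
      have hs' : 0 ≤ α * s := by positivity
      have ht' : 0 ≤ β * t := by positivity
      rcases (add_nonneg hs' ht').eq_or_lt with h0 | h0
      · refine ⟨0, le_rfl, p, hp, ?_⟩
        rw [hcomb, show α * s = 0 by linarith, show β * t = 0 by linarith]
        simp
      · refine ⟨α * s + β * t, h0.le, _, (convex_convexHull ℝ _) hp hr
          (div_nonneg hs' h0.le) (div_nonneg ht' h0.le) (by field_simp), ?_⟩
        rw [hcomb, smul_add, smul_smul, smul_smul, mul_div_cancel₀ _ h0.ne',
          mul_div_cancel₀ _ h0.ne']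
  obtain ⟨p, hp, hfp⟩ : ∃ p ∈ P.extremePoints ℝ, 0 < f p := by
    by_contra! h
    have h1 : f (q w) ≤ 0 := by
      rw [← hP.convexHull_extremePoints] at hqwP
      exact convexHull_min (t := {z | f z ≤ 0}) h
        (convex_halfSpace_le f.toLinearMap.isLinear _) hqwP
    have h2 : f w - f v = (g v - g w) * f (q w) := by
      rw [← map_sub, hqw w hwv, map_smul, smul_eq_mul]
    nlinarith [hg w hwv]
  obtain ⟨z, hz, rfl⟩ := extremePoints_convexHull_subset hp
  have hgz := hg z hz
  set p := q z with hpz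
  have hpP : p ∈ P := extremePoints_subset hp
  have hfz : f v < f z := by
    have h2 : f z - f v = (g v - g z) * f p := by
      rw [← map_sub, hqw z hz, map_smul, smul_eq_mul]
    nlinarith
  -- The edge is the part of `D` on the ray from `v` through the extreme direction `p`.
  set F : Set (EuclideanSpace ℝ (Fin n)) := {x ∈ D | ∃ t : ℝ, 0 ≤ t ∧ x - v = t • p} with hFdef
  have hFconv : Convex ℝ F := by
    rintro a ⟨ha, s, hs, has⟩ b ⟨hb, t, ht, hbt⟩ α β hα hβ hαβ
    refine ⟨hD.convex ha hb hα hβ hαβ, α * s + β * t, by positivity, ?_⟩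
    rw [add_smul, mul_smul, mul_smul, ← has, ← hbt]
    have : v = (α + β) • v := by rw [hαβ, one_smul]
    nth_rw 1 [this]
    module
  have hFext : IsExtreme ℝ D F := by
    refine ⟨fun x hx => hx.1, ?_⟩
    rintro a ha b hb x ⟨hxD, t, ht, hxt⟩ ⟨α, β, hα, hβ, hαβ, rfl⟩
    refine ⟨ha, ?_⟩
    obtain ⟨s, hs, pa, hpa, has⟩ := hcone a ha
    obtain ⟨r, hr, pb, hpb, hbr⟩ := hcone b hb
    have hcomb : t • p = (α * s) • pa + (β * r) • pb := by
      rw [mul_smul, mul_smul, ← has, ← hbr, ← hxt]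
      have : v = (α + β) • v := by rw [hαβ, one_smul]
      nth_rw 1 [this]
      module
    -- Since `g` is `-1` on `P`, it reads off the coefficients; dividing by `t` makes `p` a convex
    -- combination of `pa` and `pb`, and extremality applies.
    have hsum : t = α * s + β * r := by
      have := congrArg g hcomb
      simp only [map_add, map_smul, hgP p hpP, hgP pa hpa, hgP pb hpb, smul_eq_mul] at this
      linarith
    rcases hs.eq_or_lt with rfl | hs
    · exact ⟨0, le_rfl, by simpa using has⟩
    have hs' : 0 < α * s := by positivity
    refine ⟨s, hs.le, ?_⟩
    rcases hr.eq_or_lt with rfl | hr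
    · rw [mul_zero, add_zero] at hsum
      rw [mul_zero, zero_smul, add_zero, hsum] at hcomb
      rw [has, smul_right_injective _ hs'.ne' hcomb]
    · have hr' : 0 < β * r := by positivity
      have ht0 : 0 < t := by linarith
      have : pa = p := by
        refine (mem_extremePoints_iff_left.1 hp).2 pa hpa pb hpb
          ⟨α * s / t, β * r / t, by positivity, by positivity, by rw [hsum]; field_simp, ?_⟩
        apply smul_right_injective _ ht0.ne'
        simp only [smul_add, smul_smul, mul_div_cancel₀ _ ht0.ne', hcomb]
      rw [has, this]
  have hvF : v ∈ F := ⟨extremePoints_subset hv, 0, le_rfl, by simp⟩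
  have hzF : z ∈ F := ⟨extremePoints_subset hz.1, _, hgz.le, hqw z hz⟩
  have hdim : Module.finrank ℝ (vectorSpan ℝ F) ≤ 1 := by
    have hle : vectorSpan ℝ F ≤ Submodule.span ℝ {p} := by
      rw [vectorSpan_eq_span_vsub_set_right ℝ hvF, Submodule.span_le]
      rintro _ ⟨x, ⟨-, t, -, hxt⟩, rfl⟩
      exact Submodule.mem_span_singleton.2 ⟨t, by simpa using hxt.symm⟩
    exact (Submodule.finrank_mono hle).trans ((finrank_span_le_card _).trans (by simp))
  exact ⟨z, hz.1, hfz, fun x hx => ⟨F, ⟨hFconv, hFext⟩, hdim, hFconv.segment_subset hvF hzF hx⟩⟩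

/-! ### Connectivity of the edge graph -/

/-- Two vertices of `D` span a segment that lies in the 1-skeleton and in `A`. -/
def SkeletonAdj {n : ℕ} (D A : Set (EuclideanSpace ℝ (Fin n)))
    (v w : EuclideanSpace ℝ (Fin n)) : Prop :=
  v ∈ D.extremePoints ℝ ∧ w ∈ D.extremePoints ℝ ∧ segment ℝ v w ⊆ skeleton D 1 ∩ A

theorem SkeletonAdj.symm {n : ℕ} {D A : Set (EuclideanSpace ℝ (Fin n))}
    {v w : EuclideanSpace ℝ (Fin n)} (h : SkeletonAdj D A v w) : SkeletonAdj D A w v :=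
  ⟨h.2.1, h.1, by rw [segment_symm]; exact h.2.2⟩

/-- Two points are linked by a chain of segments between vertices of `D`, each in the 1-skeleton
and in `A`. -/
def SkeletonReachable {n : ℕ} (D A : Set (EuclideanSpace ℝ (Fin n))) :
    EuclideanSpace ℝ (Fin n) → EuclideanSpace ℝ (Fin n) → Prop :=
  Relation.ReflTransGen (SkeletonAdj D A)

theorem SkeletonReachable.symm {n : ℕ} {D A : Set (EuclideanSpace ℝ (Fin n))}
    {v w : EuclideanSpace ℝ (Fin n)} (h : SkeletonReachable D A v w) :
    SkeletonReachable D A w v := by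
  induction h with
  | refl => exact Relation.ReflTransGen.refl
  | tail _ hbc ih => exact Relation.ReflTransGen.head hbc.symm ih

theorem SkeletonReachable.trans {n : ℕ} {D A : Set (EuclideanSpace ℝ (Fin n))}
    {u v w : EuclideanSpace ℝ (Fin n)} (h : SkeletonReachable D A u v)
    (h' : SkeletonReachable D A v w) : SkeletonReachable D A u w :=
  Relation.ReflTransGen.trans h h'

theorem SkeletonReachable.imp {n : ℕ} {D A E B : Set (EuclideanSpace ℝ (Fin n))}
    (hAB : ∀ v w, SkeletonAdj D A v w → SkeletonAdj E B v w) {v w : EuclideanSpace ℝ (Fin n)}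
    (h : SkeletonReachable D A v w) : SkeletonReachable E B v w := by
  induction h with
  | refl => exact Relation.ReflTransGen.refl
  | tail _ hbc ih => exact Relation.ReflTransGen.tail ih (hAB _ _ hbc)

theorem SkeletonReachable.mono {n : ℕ} {D A B : Set (EuclideanSpace ℝ (Fin n))} (hAB : A ⊆ B)
    {v w : EuclideanSpace ℝ (Fin n)} (h : SkeletonReachable D A v w) :
    SkeletonReachable D B v w :=
  SkeletonReachable.imp (fun _ _ h => ⟨h.1, h.2.1, fun _ hx =>
    ⟨(h.2.2 hx).1, hAB (h.2.2 hx).2⟩⟩) h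

theorem SkeletonReachable.of_face {n : ℕ} {D F A B : Set (EuclideanSpace ℝ (Fin n))}
    (hF : IsFace D F) (hFB : F ⊆ B) {v w : EuclideanSpace ℝ (Fin n)}
    (h : SkeletonReachable F A v w) : SkeletonReachable D B v w :=
  SkeletonReachable.imp (fun _ _ h => ⟨hF.2.extremePoints_subset_extremePoints h.1,
    hF.2.extremePoints_subset_extremePoints h.2.1, fun _ hx =>
    ⟨hF.skeleton_subset 1 (h.2.2 hx).1, hFB (skeleton_subset F 1 (h.2.2 hx).1)⟩⟩) h

/-- From every vertex an ascending chain of edges leads to a maximum of a linear functional. -/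
theorem IsPolytope.exists_reachable_max {n : ℕ} {D : Set (EuclideanSpace ℝ (Fin n))}
    (hD : IsPolytope D) (f : StrongDual ℝ (EuclideanSpace ℝ (Fin n)))
    {v : EuclideanSpace ℝ (Fin n)} (hv : v ∈ D.extremePoints ℝ) :
    ∃ w ∈ D.extremePoints ℝ, (∀ y ∈ D, f y ≤ f w) ∧ SkeletonReachable D {x | f v ≤ f x} v w := by
  set S := {w ∈ D.extremePoints ℝ | f v ≤ f w ∧ SkeletonReachable D {x | f v ≤ f x} v w} with hS
  have hfin : S.Finite := hD.finite_extremePoints.subset fun w hw => hw.1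
  obtain ⟨w, ⟨hw, hvw, hr⟩, hmax⟩ := Set.exists_max_image S f hfin
    ⟨v, hv, le_rfl, Relation.ReflTransGen.refl⟩
  refine ⟨w, hw, ?_, hr⟩
  by_contra! h
  obtain ⟨y, hy, hwy⟩ := h
  obtain ⟨z, hz, hwz, hseg⟩ := hD.exists_ascending_edge f hw hy hwy
  have hconv : Convex ℝ {x | f v ≤ f x} := convex_halfSpace_ge f.toLinearMap.isLinear _
  exact (hmax z ⟨hz, hvw.trans hwz.le, hr.tail ⟨hw, hz, fun x hx =>
    ⟨hseg hx, hconv.segment_subset hvw (hvw.trans hwz.le) hx⟩⟩⟩).not_gt hwz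

/-- The points of a polytope where a linear functional takes its maximum form a face. -/
theorem IsPolytope.isFace_max {n : ℕ} {D : Set (EuclideanSpace ℝ (Fin n))}
    (hD : IsPolytope D) (f : StrongDual ℝ (EuclideanSpace ℝ (Fin n))) {M : ℝ}
    (hM : ∀ y ∈ D, f y ≤ M) : IsFace D {x ∈ D | f x = M} := by
  refine ⟨hD.convex.inter (convex_hyperplane f.toLinearMap.isLinear M), fun x hx => hx.1, ?_⟩
  rintro a ha b hb _ ⟨-, hx⟩ ⟨α, β, hα, hβ, hαβ, rfl⟩
  refine ⟨ha, (hM a ha).antisymm ?_⟩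
  simp only [map_add, map_smul, smul_eq_mul] at hx
  have h1 := hM b hb
  by_contra! h
  have : M = α * M + β * M := by rw [← add_mul, hαβ, one_mul]
  nlinarith

/-- The edge graph of a polytope is connected. -/
theorem IsPolytope.skeletonReachable {n : ℕ} {D : Set (EuclideanSpace ℝ (Fin n))}
    (hD : IsPolytope D) {v w : EuclideanSpace ℝ (Fin n)}
    (hv : v ∈ D.extremePoints ℝ) (hw : w ∈ D.extremePoints ℝ) :
    SkeletonReachable D Set.univ v w := by
  induction hd : Module.finrank ℝ (vectorSpan ℝ D) using Nat.strong_induction_on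
    generalizing D v w with
  | _ d ih =>
  by_cases hvw : v = w
  · exact hvw ▸ Relation.ReflTransGen.refl
  -- Separating `v` from `w` makes `f` nonconstant on `D`, so its top face has smaller dimension.
  obtain ⟨f, hf⟩ := SeparatingDual.exists_separating_of_ne (R := ℝ) hvw
  obtain ⟨v', hv', hmv, hrv⟩ := hD.exists_reachable_max f hv
  obtain ⟨w', hw', hmw, hrw⟩ := hD.exists_reachable_max f hw
  have hF := hD.isFace_max f hmv
  set F := {x ∈ D | f x = f v'} with hFdef
  have hv'F : v' ∈ F := ⟨extremePoints_subset hv', rfl⟩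
  have hw'F : w' ∈ F := ⟨extremePoints_subset hw',
    (hmv w' (extremePoints_subset hw')).antisymm (hmw v' (extremePoints_subset hv'))⟩
  have hlt : Module.finrank ℝ (vectorSpan ℝ F) < d := by
    rw [← hd]
    refine Submodule.finrank_lt_finrank_of_lt ((vectorSpan_mono ℝ hF.subset).lt_of_not_ge ?_)
    intro hle
    have hker : vectorSpan ℝ F ≤ LinearMap.ker f.toLinearMap := by
      rw [vectorSpan_eq_span_vsub_set_right ℝ hv'F, Submodule.span_le]
      rintro _ ⟨x, ⟨-, hx⟩, rfl⟩
      simp [hx]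
    have h := hker (hle (vsub_mem_vectorSpan ℝ (extremePoints_subset hv)
      (extremePoints_subset hw)))
    simp only [vsub_eq_sub, LinearMap.mem_ker, map_sub, sub_eq_zero] at h
    exact hf h
  have hmid : SkeletonReachable F Set.univ v' w' :=
    ih _ hlt (hF.isPolytope hD) (by rw [hF.2.extremePoints_eq]; exact ⟨hv'F, hv'⟩)
      (by rw [hF.2.extremePoints_eq]; exact ⟨hw'F, hw'⟩) rfl
  exact ((hrv.mono (Set.subset_univ _)).trans (hmid.of_face hF (Set.subset_univ _))).trans
    (hrw.symm.mono (Set.subset_univ _))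

/-- The vertices of a polytope in an open half-space are linked by edges in that half-space. -/
theorem IsPolytope.skeletonReachable_halfSpace {n : ℕ} {D : Set (EuclideanSpace ℝ (Fin n))}
    (hD : IsPolytope D) (f : StrongDual ℝ (EuclideanSpace ℝ (Fin n))) {c : ℝ}
    {v w : EuclideanSpace ℝ (Fin n)} (hv : v ∈ D.extremePoints ℝ) (hw : w ∈ D.extremePoints ℝ)
    (hcv : c < f v) (hcw : c < f w) :
    SkeletonReachable D {x | c < f x} v w := by
  obtain ⟨v', hv', hmv, hrv⟩ := hD.exists_reachable_max f hv
  obtain ⟨w', hw', hmw, hrw⟩ := hD.exists_reachable_max f hw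
  have hF := hD.isFace_max f hmv
  set F := {x ∈ D | f x = f v'} with hFdef
  have hv'F : v' ∈ F := ⟨extremePoints_subset hv', rfl⟩
  have hw'F : w' ∈ F := ⟨extremePoints_subset hw',
    (hmv w' (extremePoints_subset hw')).antisymm (hmw v' (extremePoints_subset hv'))⟩
  have hmid : SkeletonReachable F Set.univ v' w' :=
    (hF.isPolytope hD).skeletonReachable (by rw [hF.2.extremePoints_eq]; exact ⟨hv'F, hv'⟩)
      (by rw [hF.2.extremePoints_eq]; exact ⟨hw'F, hw'⟩)
  refine ((hrv.mono fun x hx => hcv.trans_le hx).trans (hmid.of_face hF fun x hx => ?_)).trans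
    (hrw.symm.mono fun x hx => hcw.trans_le hx)
  have := hmv v (extremePoints_subset hv)
  exact (hcv.trans_le this).trans_eq hx.2.symm

theorem IsPolytope.exists_extremePoint_lt {n : ℕ} {D : Set (EuclideanSpace ℝ (Fin n))}
    (hD : IsPolytope D) (f : StrongDual ℝ (EuclideanSpace ℝ (Fin n))) {c : ℝ}
    {x : EuclideanSpace ℝ (Fin n)} (hx : x ∈ D) (hcx : c < f x) :
    ∃ v ∈ D.extremePoints ℝ, c < f v := by
  by_contra! h
  rw [← hD.convexHull_extremePoints] at hx
  exact hcx.not_ge (convexHull_min (t := {z | f z ≤ c}) h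
    (convex_halfSpace_le f.toLinearMap.isLinear _) hx)

/-! ### Edge chains avoiding a convex set -/

/-- Vertices in two half-spaces that avoid `U` and share a point of `D` are linked by edges
avoiding `U`. -/
theorem IsPolytope.skeletonReachable_of_two_halfSpaces {n : ℕ}
    {D U : Set (EuclideanSpace ℝ (Fin n))} (hD : IsPolytope D)
    {f g : StrongDual ℝ (EuclideanSpace ℝ (Fin n))} {c d : ℝ} (hf : ∀ u ∈ U, f u < c)
    (hg : ∀ u ∈ U, g u < d) {x v w : EuclideanSpace ℝ (Fin n)} (hx : x ∈ D) (hfx : c < f x)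
    (hgx : d < g x) (hv : v ∈ D.extremePoints ℝ) (hw : w ∈ D.extremePoints ℝ) (hcv : c < f v)
    (hdw : d < g w) : SkeletonReachable D Uᶜ v w := by
  by_contra hvw
  -- For each `t` in `[0, 1]` the half-space `0 < h t` contains `x` and misses `U`.
  set h : ℝ → EuclideanSpace ℝ (Fin n) → ℝ := fun t z => (1 - t) * (f z - c) + t * (g z - d) with hh
  have hopen : ∀ z, IsOpen {t : ℝ | 0 < h t z} := fun z =>
    isOpen_lt continuous_const (by simp only [hh]; fun_prop)
  have hpos : ∀ t ∈ Set.Icc (0 : ℝ) 1, 0 < h t x := fun t ht => by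
    simp only [hh]
    rcases ht.1.eq_or_lt with rfl | h0
    · simpa using hfx
    · have := mul_nonneg (sub_nonneg.2 ht.2) (sub_pos.2 hfx).le
      have := mul_pos h0 (sub_pos.2 hgx)
      linarith
  have hneg : ∀ t ∈ Set.Icc (0 : ℝ) 1, ∀ u ∈ U, h t u ≤ 0 := fun t ht u hu => by
    have h1 := mul_nonneg (sub_nonneg.2 ht.2) (sub_pos.2 (hf u hu)).le
    have h2 := mul_nonneg ht.1 (sub_pos.2 (hg u hu)).le
    simp only [hh]
    linarith
  have hfun : ∀ t z, h t z = ((1 - t) • f + t • g) z - ((1 - t) * c + t * d) := fun t z => by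
    simp [hh]; ring
  -- Each half-space contains a vertex, so these two open sets of parameters cover `[0, 1]`. At a
  -- common `t`, one half-space holds both a reachable and an unreachable vertex.
  obtain ⟨t, ht, ht1, ht2⟩ := isPreconnected_Icc (a := (0 : ℝ)) (b := 1)
    (⋃ z ∈ {z ∈ D.extremePoints ℝ | SkeletonReachable D Uᶜ v z}, {t : ℝ | 0 < h t z})
    (⋃ z ∈ {z ∈ D.extremePoints ℝ | ¬ SkeletonReachable D Uᶜ v z}, {t : ℝ | 0 < h t z})
    (isOpen_biUnion fun z _ => hopen z) (isOpen_biUnion fun z _ => hopen z)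
    (fun t ht => by
      have hx' := hpos t ht
      rw [hfun, sub_pos] at hx'
      obtain ⟨z, hz, hcz⟩ := hD.exists_extremePoint_lt _ hx hx'
      have hcz' : 0 < h t z := by rw [hfun, sub_pos]; exact hcz
      by_cases hvz : SkeletonReachable D Uᶜ v z
      · exact Or.inl (Set.mem_biUnion (x := z) ⟨hz, hvz⟩ hcz')
      · exact Or.inr (Set.mem_biUnion (x := z) ⟨hz, hvz⟩ hcz'))
    ⟨0, by simp, Set.mem_biUnion (x := v) ⟨hv, Relation.ReflTransGen.refl⟩ (by simpa [hh] using hcv)⟩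
    ⟨1, by simp, Set.mem_biUnion (x := w) ⟨hw, hvw⟩ (by simpa [hh] using hdw)⟩
  simp only [Set.mem_iUnion, exists_prop] at ht1 ht2
  obtain ⟨a, ⟨ha, hva⟩, hta⟩ := ht1
  obtain ⟨b, ⟨hb, hvb⟩, htb⟩ := ht2
  have hta : 0 < h t a := hta
  have htb : 0 < h t b := htb
  rw [hfun, sub_pos] at hta htb
  refine hvb (hva.trans ((hD.skeletonReachable_halfSpace _ ha hb hta htb).mono fun z hz hzU => ?_))
  have h1 := hneg t ht z hzU
  rw [hfun] at h1
  have hz : (1 - t) * c + t * d < ((1 - t) • f + t • g) z := hz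
  linarith

/-- Vertices in a connected subset of `D` disjoint from a closed convex set `U` are linked by edges
avoiding `U`. -/
theorem IsPolytope.skeletonReachable_of_isPreconnected {n : ℕ}
    {D U S : Set (EuclideanSpace ℝ (Fin n))} (hD : IsPolytope D) (hU : Convex ℝ U)
    (hUc : IsClosed U) (hS : IsPreconnected S) (hSD : S ⊆ D \ U)
    {a b : EuclideanSpace ℝ (Fin n)} (ha : a ∈ D.extremePoints ℝ) (hb : b ∈ D.extremePoints ℝ)
    (haS : a ∈ S) (hbS : b ∈ S) : SkeletonReachable D Uᶜ a b := by
  by_contra hab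
  -- Points that some half-space missing `U` groups with a vertex in `K`; reachable and unreachable
  -- vertices give two open sets covering `S`.
  let O : Set (EuclideanSpace ℝ (Fin n)) → Set (EuclideanSpace ℝ (Fin n)) := fun K =>
    {x | ∃ (f : StrongDual ℝ (EuclideanSpace ℝ (Fin n))) (c : ℝ), (∀ u ∈ U, f u < c) ∧ c < f x ∧
      ∃ v ∈ D.extremePoints ℝ ∩ K, c < f v}
  have hO : ∀ K, IsOpen (O K) := fun K => isOpen_iff_mem_nhds.2 <| by
    rintro x ⟨f, c, hf, hx, hv⟩
    filter_upwards [(isOpen_lt continuous_const f.continuous).mem_nhds hx] with y hy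
    exact ⟨f, c, hf, hy, hv⟩
  have hsep : ∀ x ∈ S, ∃ (f : StrongDual ℝ (EuclideanSpace ℝ (Fin n))) (c : ℝ),
      (∀ u ∈ U, f u < c) ∧ c < f x := fun x hx =>
    geometric_hahn_banach_closed_point hU hUc (hSD hx).2
  obtain ⟨x, hx, ⟨f, c, hf, hfx, v, ⟨hv, hav⟩, hcv⟩, ⟨g, d, hg, hgx, w, ⟨hw, haw⟩, hdw⟩⟩ :=
    hS (O {v | SkeletonReachable D Uᶜ a v}) (O {v | ¬ SkeletonReachable D Uᶜ a v}) (hO _) (hO _)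
    (fun x hx => by
      obtain ⟨f, c, hf, hfx⟩ := hsep x hx
      obtain ⟨v, hv, hcv⟩ := hD.exists_extremePoint_lt f (hSD hx).1 hfx
      by_cases h : SkeletonReachable D Uᶜ a v
      · exact Or.inl ⟨f, c, hf, hfx, v, ⟨hv, h⟩, hcv⟩
      · exact Or.inr ⟨f, c, hf, hfx, v, ⟨hv, h⟩, hcv⟩)
    (by
      obtain ⟨f, c, hf, hfx⟩ := hsep a haS
      exact ⟨a, haS, f, c, hf, hfx, a, ⟨ha, Relation.ReflTransGen.refl⟩, hfx⟩)
    (by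
      obtain ⟨f, c, hf, hfx⟩ := hsep b hbS
      exact ⟨b, hbS, f, c, hf, hfx, b, ⟨hb, hab⟩, hfx⟩)
  exact haw (SkeletonReachable.trans hav
    (hD.skeletonReachable_of_two_halfSpaces hf hg (hSD hx).1 hfx hgx hv hw hcv hdw))

/-- Closedness of `U` is not needed: only finitely many points of `U` matter. -/
theorem IsPolytope.skeletonReachable_of_isPreconnected_of_convex {n : ℕ}
    {D U S : Set (EuclideanSpace ℝ (Fin n))} (hD : IsPolytope D) (hU : Convex ℝ U)
    (hS : IsPreconnected S) (hSD : S ⊆ D \ U)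
    {a b : EuclideanSpace ℝ (Fin n)} (ha : a ∈ D.extremePoints ℝ) (hb : b ∈ D.extremePoints ℝ)
    (haS : a ∈ S) (hbS : b ∈ S) : SkeletonReachable D Uᶜ a b := by
  classical
  -- One witness in `U` is chosen on each vertex segment meeting `U`. Their hull is compact, and a
  -- vertex segment missing the hull misses `U`.
  set T := {p ∈ D.extremePoints ℝ ×ˢ D.extremePoints ℝ | (segment ℝ p.1 p.2 ∩ U).Nonempty} with hT
  have hTfin : T.Finite :=
    (hD.finite_extremePoints.prod hD.finite_extremePoints).subset fun p hp => hp.1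
  have hex : ∀ p, ∃ u, p ∈ T → u ∈ segment ℝ p.1 p.2 ∩ U := fun p => by
    by_cases hp : p ∈ T
    · exact ⟨hp.2.some, fun _ => hp.2.some_mem⟩
    · exact ⟨0, fun h => absurd h hp⟩
  choose u hu using hex
  have hsub : convexHull ℝ (u '' T) ⊆ U := convexHull_min
    (by rintro _ ⟨p, hp, rfl⟩; exact (hu p hp).2) hU
  have hreach := hD.skeletonReachable_of_isPreconnected (convex_convexHull ℝ (u '' T))
    ((hTfin.image u).isCompact_convexHull ℝ).isClosed hS
    (fun x hx => ⟨(hSD hx).1, fun h => (hSD hx).2 (hsub h)⟩) ha hb haS hbS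
  refine SkeletonReachable.imp (fun v w h => ⟨h.1, h.2.1, fun x hx =>
    ⟨(h.2.2 hx).1, fun hxU => ?_⟩⟩) hreach
  have hp : (v, w) ∈ T := ⟨⟨h.1, h.2.1⟩, x, hx, hxU⟩
  exact (h.2.2 (hu _ hp).1).2 (subset_convexHull ℝ _ ⟨_, hp, rfl⟩)

/-! ### Path components -/

theorem SkeletonReachable.joinedIn {n : ℕ} {D U : Set (EuclideanSpace ℝ (Fin n))}
    {v w : EuclideanSpace ℝ (Fin n)} (h : SkeletonReachable D Uᶜ v w)
    (hv : v ∈ skeleton D 1 \ U) : JoinedIn (skeleton D 1 \ U) v w := by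
  induction h with
  | refl => exact JoinedIn.refl hv
  | tail _ hbc ih => exact ih.trans (JoinedIn.of_segment_subset hbc.2.2)

theorem pathComponentIn_mem_pathConnectedComponents {X : Type*} [TopologicalSpace X] {P : Set X}
    {x : X} (hx : x ∈ P) : pathComponentIn P x ∈ pathConnectedComponents P :=
  ⟨⟨pathComponentIn_subset, isPathConnected_pathComponentIn hx⟩, fun _ hS hle =>
    hS.2.subset_pathComponentIn (hle (mem_pathComponentIn_self hx)) hS.1⟩

theorem eq_pathComponentIn_of_mem_pathConnectedComponents {X : Type*} [TopologicalSpace X]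
    {P W : Set X} (hW : W ∈ pathConnectedComponents P) {x : X} (hx : x ∈ W) :
    W = pathComponentIn P x :=
  Maximal.eq_of_le (P := fun S : Set X => S ⊆ P ∧ IsPathConnected S) hW (pathComponentIn_mem_pathConnectedComponents (hW.1.1 hx)).1
    (hW.1.2.subset_pathComponentIn hx hW.1.1)

theorem nonempty_of_mem_pathConnectedComponents {X : Type*} [TopologicalSpace X]
    {P W : Set X} (hW : W ∈ pathConnectedComponents P) : W.Nonempty :=
  hW.1.2.nonempty

/-- A point of the 1-skeleton slides within its own low-dimensional face to a vertex, still outside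
`U`; edge chains then link that vertex to `v`. -/
theorem IsPolytope.pathComponentIn_inter_skeleton {n : ℕ} {D U : Set (EuclideanSpace ℝ (Fin n))}
    (hD : IsPolytope D) (hU : Convex ℝ U) {v : EuclideanSpace ℝ (Fin n)}
    (hv : v ∈ D.extremePoints ℝ) (hvU : v ∉ U) :
    pathComponentIn (D \ U) v ∩ skeleton D 1 = pathComponentIn (skeleton D 1 \ U) v := by
  have hsub : skeleton D 1 \ U ⊆ D \ U := Set.sdiff_subset_sdiff_left (skeleton_subset D 1)
  refine Set.Subset.antisymm ?_ fun x hx =>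
    ⟨pathComponentIn_mono hsub hx, (pathComponentIn_subset hx).1⟩
  rintro x ⟨hx, F, hF, hdim, hxF⟩
  have hxU : x ∉ U := (pathComponentIn_subset hx).2
  obtain ⟨w, hw, hseg⟩ := hF.exists_segment_disjoint hD hU hxF hxU
  have hxw : JoinedIn (skeleton D 1 \ U) x w := JoinedIn.of_segment_subset fun y hy =>
    ⟨⟨F, hF, hdim, (hseg hy).1⟩, (hseg hy).2⟩
  have hvw : w ∈ pathComponentIn (D \ U) v := JoinedIn.trans hx (hxw.mono hsub)
  have hvD : v ∈ D \ U := ⟨extremePoints_subset hv, hvU⟩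
  have hr := hD.skeletonReachable_of_isPreconnected_of_convex hU
    (isPathConnected_pathComponentIn hvD).isConnected.isPreconnected pathComponentIn_subset hv hw
    (mem_pathComponentIn_self hvD) hvw
  exact (hr.joinedIn ⟨extremePoints_subset_skeleton D 1 hv, hvU⟩).trans hxw.symm

theorem proposition2p1 (n : ℕ) (D U : Set (EuclideanSpace ℝ (Fin n)))
    (hD : IsPolytope D) (hU : Convex ℝ U) :
    (pathConnectedComponents (D \ U)).Finite ∧
    (∀ W ∈ pathConnectedComponents (D \ U), (W ∩ D.extremePoints ℝ).Nonempty) ∧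
    (pathConnectedComponents (skeleton D 1 \ U)).Finite ∧
    (pathConnectedComponents (skeleton D 1 \ U)).ncard =
      (pathConnectedComponents (D \ U)).ncard ∧
    Set.BijOn (fun W => W ∩ skeleton D 1)
      (pathConnectedComponents (D \ U)) (pathConnectedComponents (skeleton D 1 \ U)) := by
  have hvert : ∀ W ∈ pathConnectedComponents (D \ U), (W ∩ D.extremePoints ℝ).Nonempty := by
    intro W hW
    obtain ⟨x, hx⟩ := nonempty_of_mem_pathConnectedComponents hW
    have hxD := hW.1.1 hx
    obtain ⟨v, hv, hseg⟩ := (IsFace.self hD).exists_segment_disjoint hD hU hxD.1 hxD.2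
    refine ⟨v, ?_, hv⟩
    rw [eq_pathComponentIn_of_mem_pathConnectedComponents hW hx]
    exact JoinedIn.of_segment_subset hseg
  have hfin : (pathConnectedComponents (D \ U)).Finite := by
    refine (hD.finite_extremePoints.image (pathComponentIn (D \ U))).subset fun W hW => ?_
    obtain ⟨v, hvW, hv⟩ := hvert W hW
    exact ⟨v, hv, (eq_pathComponentIn_of_mem_pathConnectedComponents hW hvW).symm⟩
  have hmaps : ∀ W ∈ pathConnectedComponents (D \ U),
      W ∩ skeleton D 1 ∈ pathConnectedComponents (skeleton D 1 \ U) := by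
    intro W hW
    obtain ⟨v, hvW, hv⟩ := hvert W hW
    have hvU : v ∉ U := (hW.1.1 hvW).2
    rw [eq_pathComponentIn_of_mem_pathConnectedComponents hW hvW,
      hD.pathComponentIn_inter_skeleton hU hv hvU]
    exact pathComponentIn_mem_pathConnectedComponents ⟨extremePoints_subset_skeleton D 1 hv, hvU⟩
  have hbij : Set.BijOn (fun W => W ∩ skeleton D 1)
      (pathConnectedComponents (D \ U)) (pathConnectedComponents (skeleton D 1 \ U)) := by
    refine ⟨hmaps, fun W hW W' hW' h => ?_, fun Z hZ => ?_⟩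
    · obtain ⟨x, hx⟩ := nonempty_of_mem_pathConnectedComponents (hmaps W hW)
      have hx' : x ∈ W' ∩ skeleton D 1 := (show W ∩ skeleton D 1 = W' ∩ skeleton D 1 from h) ▸ hx
      rw [eq_pathComponentIn_of_mem_pathConnectedComponents hW hx.1,
        eq_pathComponentIn_of_mem_pathConnectedComponents hW' hx'.1]
    · obtain ⟨x, hx⟩ := nonempty_of_mem_pathConnectedComponents hZ
      have hxS := hZ.1.1 hx
      have hxD : x ∈ D \ U := ⟨skeleton_subset D 1 hxS.1, hxS.2⟩
      have hW := pathComponentIn_mem_pathConnectedComponents hxD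
      refine ⟨_, hW, ?_⟩
      rw [eq_pathComponentIn_of_mem_pathConnectedComponents hZ hx]
      exact eq_pathComponentIn_of_mem_pathConnectedComponents (hmaps _ hW)
        ⟨mem_pathComponentIn_self hxD, hxS.1⟩
  refine ⟨hfin, hvert, ?_, ?_, hbij⟩
  · rw [← hbij.image_eq]
    exact hfin.image _
  · rw [← hbij.image_eq, hbij.injOn.ncard_image]
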